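/- Let $g\ge 1$ and let $(e_1,\dots,e_g)$ be a polarisation type, i.e. positive integers with $e_i\mid e_{i+1}$ for $1\le i<g$. Put $d_i:=e_{i+1}/e_i$ for $1\le i\le g-1$, and assume that the type is square-free (every $d_i$ is square-free) and coprime ($\gcd(d_i,d_j)=1$ for all $i\ne j$). Let $\Delta=\operatorname{diag}(e_1,\dots,e_g)$, $\Lambda=\begin{pmatrix}0&\Delta\\-\Delta&0\end{pmatrix}$, let $\langle x,y\rangle=x\Lambda\,{}^t y$ for row vectors $x,y\in\mathbb{Q}^{2g}$, and let $$\tilde\Gamma_{\mathrm{pol}}=\{M\in \mathrm{SL}(2g,\mathbb{Z}) : M\Lambda\,{}^tM=\Lambda\}$$ be the paramodular group, acting on $\mathbb{Q}^{2g}$ by matrix multiplication from the right. A subspace $V\subset\mathbb{Q}^{2g}$ is isotropic if $\langle u,v\rangle=0$ for all $u,v\in V$. Then $\tilde\Gamma_{\mathrm{pol}}$ acts transitively on the set of $g$-dimensional isotropic subspaces of $\mathbb{Q}^{2g}$, and there is exactly one orbit (one top-dimensional cusp). Moreover, for every $g$-dimensional isotropic subspace $h\subset\mathbb{Q}^{2g}$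 there are a $\mathbb{Z}$-basis $u^1,\dots,u^g$ of the lattice $h\cap\mathbb{Z}^{2g}$ and an element $M\in\tilde\Gamma_{\mathrm{pol}}$ such that $u^iM=\epsilon_i$ for $i=1,\dots,g$, where $\epsilon_i$ is the $i$-th standard unit vector of $\mathbb{Z}^{2g}$. -/

import Mathlib

open scoped Matrix

namespace Paramodular

/-- A polarisation type: positive integers `e₁, …, e_g` with `e_i ∣ e_{i+1}`. -/
structure PolarisationType (g : ℕ) where
  /-- the entries `e₁, …, e_g` -/
  e : Fin g → ℕ
  pos : ∀ i, 0 < e i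
  dvd_succ : ∀ i j : Fin g, (j : ℕ) = i + 1 → e i ∣ e j

variable {g : ℕ}

/-- The successive quotients `d_i = e_{i+1} / e_i`, `i = 1, …, g - 1`. -/
def PolarisationType.d (t : PolarisationType g) (i : Fin (g - 1)) : ℕ :=
  t.e ⟨(i : ℕ) + 1, by omega⟩ / t.e ⟨(i : ℕ), by omega⟩

/-- All `d_i` are square-free. -/
def PolarisationType.IsSquarefree (t : PolarisationType g) : Prop :=
  ∀ i, Squarefree (t.d i)

/-- The `d_i` are pairwise coprime. -/
def PolarisationType.IsCoprime (t : PolarisationType g) : Prop :=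
  ∀ i j, i ≠ j → Nat.gcd (t.d i) (t.d j) = 1

/-- Index set of the `2g` coordinates: `Sum.inl i` is coordinate number `i`,
`Sum.inr i` is coordinate number `g + i`. -/
abbrev Idx (g : ℕ) : Type := Fin g ⊕ Fin g

/-- `Λ = (0, Δ; -Δ, 0)` with `Δ = diag(e₁, …, e_g)`. -/
def polMatrix (t : PolarisationType g) : Matrix (Idx g) (Idx g) ℤ :=
  Matrix.fromBlocks 0 (Matrix.diagonal fun i => (t.e i : ℤ))
    (-Matrix.diagonal fun i => (t.e i : ℤ)) 0

/-- The paramodular group `{M ∈ SL(2g, ℤ) | M Λ Mᵀ = Λ}`. -/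
def paramodularGroup (t : PolarisationType g) :
    Subgroup (Matrix.SpecialLinearGroup (Idx g) ℤ) where
  carrier := {M | (M : Matrix (Idx g) (Idx g) ℤ) * polMatrix t *
    (M : Matrix (Idx g) (Idx g) ℤ)ᵀ = polMatrix t}
  one_mem' := by simp
  mul_mem' := by
    intro A B hA hB
    simp only [Set.mem_ofPred_eq] at hA hB ⊢
    rw [Matrix.SpecialLinearGroup.coe_mul, Matrix.transpose_mul]
    calc _ = (A : Matrix (Idx g) (Idx g) ℤ) * ((B : Matrix (Idx g) (Idx g) ℤ) * polMatrix t *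
          (B : Matrix (Idx g) (Idx g) ℤ)ᵀ) * (A : Matrix (Idx g) (Idx g) ℤ)ᵀ := by
            simp only [Matrix.mul_assoc]
      _ = _ := by rw [hB, hA]
  inv_mem' := by
    intro A hA
    simp only [Set.mem_ofPred_eq] at hA ⊢
    have h1 : ((A⁻¹ : Matrix.SpecialLinearGroup (Idx g) ℤ) : Matrix (Idx g) (Idx g) ℤ) *
        (A : Matrix (Idx g) (Idx g) ℤ) = 1 := by
      rw [← Matrix.SpecialLinearGroup.coe_mul, inv_mul_cancel,
        Matrix.SpecialLinearGroup.coe_one]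
    have h2 : (A : Matrix (Idx g) (Idx g) ℤ)ᵀ *
        ((A⁻¹ : Matrix.SpecialLinearGroup (Idx g) ℤ) : Matrix (Idx g) (Idx g) ℤ)ᵀ = 1 := by
      rw [← Matrix.transpose_mul, h1, Matrix.transpose_one]
    conv_lhs => rw [← hA]
    calc _ = (((A⁻¹ : Matrix.SpecialLinearGroup (Idx g) ℤ) : Matrix (Idx g) (Idx g) ℤ) *
          (A : Matrix (Idx g) (Idx g) ℤ)) * polMatrix t * ((A : Matrix (Idx g) (Idx g) ℤ)ᵀ *
          ((A⁻¹ : Matrix.SpecialLinearGroup (Idx g) ℤ) : Matrix (Idx g) (Idx g) ℤ)ᵀ) := by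
            simp only [Matrix.mul_assoc]
      _ = _ := by rw [h1, h2, one_mul, mul_one]

/-- An integer matrix seen as a rational one. -/
abbrev toRat (M : Matrix (Idx g) (Idx g) ℤ) : Matrix (Idx g) (Idx g) ℚ :=
  M.map (Int.castRingHom ℚ)

/-- The form `⟨x, y⟩ = x Λ yᵀ` on row vectors in `ℚ^{2g}`. -/
def polForm (t : PolarisationType g) (x y : Idx g → ℚ) : ℚ :=
  (x ᵥ* toRat (polMatrix t)) ⬝ᵥ y

/-- Right multiplication `v ↦ v M` on row vectors in `ℚ^{2g}`. -/
def rightMul (M : Matrix.SpecialLinearGroup (Idx g) ℤ) :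
    (Idx g → ℚ) →ₗ[ℚ] (Idx g → ℚ) :=
  (toRat (M : Matrix (Idx g) (Idx g) ℤ)).vecMulLinear

theorem rightMul_apply (M : Matrix.SpecialLinearGroup (Idx g) ℤ) (v : Idx g → ℚ) :
    rightMul M v = v ᵥ* toRat (M : Matrix (Idx g) (Idx g) ℤ) := rfl

theorem rightMul_one : rightMul (1 : Matrix.SpecialLinearGroup (Idx g) ℤ) = LinearMap.id := by
  ext1 v
  simp [rightMul, LinearMap.ext_iff]

theorem rightMul_mul (M N : Matrix.SpecialLinearGroup (Idx g) ℤ) :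
    rightMul (M * N) = rightMul N ∘ₗ rightMul M := by
  refine LinearMap.ext fun v => ?_
  simp only [rightMul_apply, LinearMap.comp_apply, Matrix.SpecialLinearGroup.coe_mul, toRat,
    Matrix.map_mul, Matrix.vecMul_vecMul]

theorem rightMul_injective (M : Matrix.SpecialLinearGroup (Idx g) ℤ) :
    Function.Injective (rightMul M) := by
  have h : rightMul M⁻¹ ∘ₗ rightMul M = LinearMap.id := by
    rw [← rightMul_mul, mul_inv_cancel, rightMul_one]
  exact Function.LeftInverse.injective (g := rightMul M⁻¹) fun v => LinearMap.congr_fun h v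

theorem polForm_rightMul (t : PolarisationType g) {M : Matrix.SpecialLinearGroup (Idx g) ℤ}
    (hM : M ∈ paramodularGroup t) (x y : Idx g → ℚ) :
    polForm t (rightMul M x) (rightMul M y) = polForm t x y := by
  have h : toRat (M : Matrix (Idx g) (Idx g) ℤ) * toRat (polMatrix t) *
      (toRat (M : Matrix (Idx g) (Idx g) ℤ))ᵀ = toRat (polMatrix t) := by
    have h0 : (M : Matrix (Idx g) (Idx g) ℤ) * polMatrix t *
      (M : Matrix (Idx g) (Idx g) ℤ)ᵀ = polMatrix t := hM
    conv_rhs => rw [← h0]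
    simp only [toRat, Matrix.map_mul, Matrix.transpose_map]
  unfold polForm
  rw [rightMul_apply, rightMul_apply, ← Matrix.mulVec_transpose _ y, Matrix.dotProduct_mulVec,
    Matrix.vecMul_vecMul, Matrix.vecMul_vecMul, ← Matrix.mul_assoc, h]

/-- A subspace of `ℚ^{2g}` on which the form vanishes identically. -/
def IsIsotropic (t : PolarisationType g) (V : Submodule ℚ (Idx g → ℚ)) : Prop :=
  ∀ u ∈ V, ∀ v ∈ V, polForm t u v = 0

/-- The `g`-dimensional isotropic subspaces of `ℚ^{2g}`. -/
def TopIsotropic (t : PolarisationType g) : Type :=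
  {V : Submodule ℚ (Idx g → ℚ) // IsIsotropic t V ∧ Module.finrank ℚ V = g}

/-- The paramodular group acts on the `g`-dimensional isotropic subspaces by matrix
multiplication from the right, `V ↦ V M`; as a left action, this is an action of the
opposite group. -/
instance (t : PolarisationType g) : MulAction (paramodularGroup t)ᵐᵒᵖ (TopIsotropic t) where
  smul M V := ⟨V.1.map (rightMul M.unop.1), by
    refine ⟨?_, ?_⟩
    · rintro _ ⟨u, hu, rfl⟩ _ ⟨v, hv, rfl⟩
      rw [polForm_rightMul t M.unop.2]
      exact V.2.1 u hu v hv
    · exact (LinearEquiv.finrank_eq (Submodule.equivMapOfInjective _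
        (rightMul_injective M.unop.1) V.1)).symm.trans V.2.2⟩
  one_smul V := by
    apply Subtype.ext
    change V.1.map (rightMul 1) = V.1
    rw [rightMul_one, Submodule.map_id]
  mul_smul M N V := by
    apply Subtype.ext
    change V.1.map (rightMul (N.unop.1 * M.unop.1)) =
      (V.1.map (rightMul N.unop.1)).map (rightMul M.unop.1)
    rw [rightMul_mul, Submodule.map_comp]

/-- The top-dimensional cusps: the orbits of the paramodular group on the `g`-dimensional
isotropic subspaces. -/
abbrev TopCusps (t : PolarisationType g) : Type :=
  MulAction.orbitRel.Quotient (paramodularGroup t)ᵐᵒᵖ (TopIsotropic t)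

/-- The lattice `V ∩ ℤ^{2g}` of integral points of a subspace `V` of `ℚ^{2g}`. -/
def integralPoints (V : Submodule ℚ (Idx g → ℚ)) : Submodule ℤ (Idx g → ℤ) where
  carrier := {x | (fun k => (x k : ℚ)) ∈ V}
  zero_mem' := by
    have h : (fun k => (((0 : Idx g → ℤ) k : ℤ) : ℚ)) = 0 := by ext; simp
    simp only [Set.mem_ofPred_eq, h, V.zero_mem]
  add_mem' := by
    intro x y hx hy
    have h : (fun k => (((x + y) k : ℤ) : ℚ)) = (fun k => (x k : ℚ)) + fun k => (y k : ℚ) := by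
      ext; simp
    simp only [Set.mem_ofPred_eq, h] at hx hy ⊢
    exact V.add_mem hx hy
  smul_mem' := by
    intro c x hx
    have h : (fun k => (((c • x) k : ℤ) : ℚ)) = (c : ℚ) • fun k => (x k : ℚ) := by
      ext; simp
    simp only [Set.mem_ofPred_eq, h] at hx ⊢
    exact V.smul_mem _ hx

end Paramodular

namespace Paramodular

/-! Dividing the form by `e₁` gives an alternating form `E` on `L = ℤ^{2g}` whose type divides the
square-free `N = ∏ d_i`, so that `N` times any functional on `L` is represented by `E`. The lattice
`U = h ∩ ℤ^{2g}` equals its own orthogonal. It suffices to find a basis of `L` in which `E` has its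
standard matrix and whose first half is a basis of `U`: its vectors are the rows of a matrix `P`
preserving the form, and `M = P⁻¹`.

Such a basis is built by splitting off planes (`exists_isAdapted`). Let `c` be the least positive
value of `E` on `U × L`, attained at `(u, w)`. It divides all values on `U × L`
(`exists_pair_dvd_pairing`) and, because `N` is square-free, all values on `L × L`
(`dvd_form_of_dvd_pairing`). Hence `L` is the sum of the span of `u, w` and its orthogonal, to which
every hypothesis passes.

The resulting type agrees with the original one by comparing ranks modulo primes
(`eq_of_mul_stdMatrix`), and `det P = 1` since `P` is conjugate to a symplectic matrix over `ℚ`. -/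

theorem exists_retraction {L : Type*} [AddCommGroup L] [Module.Finite ℤ L] (U : Submodule ℤ L)
    (hU : ∀ (n : ℤ) (x : L), n ≠ 0 → n • x ∈ U → x ∈ U) :
    ∃ r : L →ₗ[ℤ] U, ∀ x : U, r x = x := by
  have : Module.IsTorsionFree ℤ (L ⧸ U) := by
    refine Module.IsTorsionFree.of_smul_eq_zero fun n x hx => ?_
    obtain ⟨y, rfl⟩ := U.mkQ_surjective x
    rw [or_iff_not_imp_left]
    intro hn
    rw [← map_smul, Submodule.mkQ_apply, Submodule.Quotient.mk_eq_zero] at hx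
    rw [Submodule.mkQ_apply, Submodule.Quotient.mk_eq_zero]
    exact hU n y hn hx
  have : Module.Free ℤ (L ⧸ U) := Module.free_of_finite_type_torsion_free'
  obtain ⟨s, hs⟩ := Module.projective_lifting_property U.mkQ LinearMap.id U.mkQ_surjective
  refine ⟨LinearMap.codRestrict U (LinearMap.id - s ∘ₗ U.mkQ) fun x => ?_, fun x => ?_⟩
  · have := LinearMap.congr_fun hs (U.mkQ x)
    rw [← Submodule.Quotient.mk_eq_zero, ← Submodule.mkQ_apply]
    simpa [sub_eq_zero] using this.symm
  · ext
    have : U.mkQ (x : L) = 0 := by simp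
    simp [this]

/-! ### Splitting off planes along a self-orthogonal sublattice -/

/-- Families `u` in `U` and `w` in `L` that together span `L` and in which the form `E` takes
the standard shape of type `f`. -/
structure IsAdapted {L : Type*} [AddCommGroup L] (E : L →ₗ[ℤ] L →ₗ[ℤ] ℤ) (U : Submodule ℤ L)
    {g : ℕ} (f : Fin g → ℕ) (u w : Fin g → L) : Prop where
  mem : ∀ i, u i ∈ U
  pair : ∀ i j, E (u i) (w j) = if i = j then (f i : ℤ) else 0
  iso : ∀ i j, E (w i) (w j) = 0
  dvd : ∀ i j, i ≤ j → f i ∣ f j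
  pos : ∀ i, 0 < f i
  span : Submodule.span ℤ (Set.range u ∪ Set.range w) = ⊤

section Lattice

variable {L : Type*} [AddCommGroup L] {E : L →ₗ[ℤ] L →ₗ[ℤ] ℤ} {U : Submodule ℤ L}

/-- Take `c` to be the least positive value on `U × L`; any remainder modulo `c` that is again a
value must vanish. -/
theorem exists_pair_dvd_pairing (hne : ∃ u ∈ U, ∃ w, E u w ≠ 0) :
    ∃ u ∈ U, ∃ w, ∃ c : ℕ, 0 < c ∧ E u w = c ∧ ∀ u' ∈ U, ∀ w', (c : ℤ) ∣ E u' w' := by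
  classical
  have hex : ∃ n : ℕ, 0 < n ∧ ∃ u ∈ U, ∃ w, E u w = n := by
    obtain ⟨u, hu, w, h⟩ := hne
    rcases lt_or_gt_of_ne h with h | h
    · exact ⟨(E u (-w)).toNat, by simpa using h, u, hu, -w, by simp; omega⟩
    · exact ⟨(E u w).toNat, by simpa using h, u, hu, w, by omega⟩
  obtain ⟨hc, u, hu, w, huw⟩ := Nat.find_spec hex
  have hmin : ∀ u' ∈ U, ∀ w', 0 ≤ E u' w' → E u' w' < Nat.find hex → E u' w' = 0 := by
    intro u' hu' w' h0 h1
    by_contra h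
    exact Nat.find_min hex (m := (E u' w').toNat) (by omega)
      ⟨by omega, u', hu', w', by omega⟩
  generalize Nat.find hex = c at hc huw hmin
  have hc' : (0 : ℤ) < c := by exact_mod_cast hc
  have h1 : ∀ w', (c : ℤ) ∣ E u w' := fun w' => by
    have h : E u (w' - (E u w' / c) • w) = E u w' % c := by
      simp [huw, Int.emod_def, mul_comm]
    have := hmin u hu (w' - (E u w' / c) • w) (h ▸ Int.emod_nonneg _ hc'.ne')
      (h ▸ Int.emod_lt_of_pos _ hc')
    exact Int.dvd_of_emod_eq_zero (h ▸ this)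
  have h2 : ∀ u' ∈ U, (c : ℤ) ∣ E u' w := fun u' hu' => by
    have h : E (u' - (E u' w / c) • u) w = E u' w % c := by
      simp [huw, Int.emod_def, mul_comm]
    have := hmin _ (U.sub_mem hu' (U.smul_mem (E u' w / c) hu)) w
      (h ▸ Int.emod_nonneg _ hc'.ne') (h ▸ Int.emod_lt_of_pos _ hc')
    exact Int.dvd_of_emod_eq_zero (h ▸ this)
  refine ⟨u, hu, w, c, hc, huw, fun u' hu' w' => ?_⟩
  obtain ⟨a, ha⟩ := h2 u' hu'
  obtain ⟨b, hb⟩ := h1 w'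
  -- `m` is the pairing of `u' - a • u` with `w' - b • w`, which are orthogonal to `w` and `u`
  -- respectively. Adding `u` on the left lets a multiple of `w` on the right reduce `m` modulo `c`.
  set m := E u' w' - c * a * b with hm
  have h : E (u + (u' - a • u)) (w' - b • w - (m / c) • w) = m % c := by
    simp only [map_add, map_sub, map_smul, LinearMap.add_apply, LinearMap.sub_apply,
      LinearMap.smul_apply, smul_eq_mul, huw, ha, hb, Int.emod_def]
    rw [hm]; ring
  have := hmin _ (U.add_mem hu (U.sub_mem hu' (U.smul_mem a hu))) (w' - b • w - (m / c) • w)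
    (h ▸ Int.emod_nonneg _ hc'.ne') (h ▸ Int.emod_lt_of_pos _ hc')
  have h3 : (c : ℤ) ∣ m := Int.dvd_of_emod_eq_zero (h ▸ this)
  have h4 : E u' w' = m + c * (a * b) := by rw [hm]; ring
  rw [h4]
  exact dvd_add h3 (dvd_mul_right _ _)

/-- On `U` one has `E v = c φ`, with `φ` extended to `L` by a retraction, and `N φ = E z` for some
`z`. The choice `v = w` gives `φ u = 1`, hence `N = c n`. For `v = x`, the vector `z - n x` is
orthogonal to `U`, so lies in `U`; thus `c` divides `n E x y`, and `c` is coprime to `n` because `N`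
is square-free. -/
theorem dvd_form_of_dvd_pairing [Module.Finite ℤ L] {N : ℤ} (hN : Squarefree N)
    (hdual : ∀ φ : L →ₗ[ℤ] ℤ, ∃ z, ∀ x, E z x = N * φ x)
    (hU : ∀ x, x ∈ U ↔ ∀ y ∈ U, E x y = 0)
    {u w : L} (hu : u ∈ U) {c : ℤ} (hc : c ≠ 0) (huw : E w u = c)
    (hcU : ∀ y, ∀ x ∈ U, c ∣ E y x) (hcU' : ∀ x ∈ U, ∀ y, c ∣ E x y) (x y : L) :
    c ∣ E x y := by
  obtain ⟨r, hr⟩ := exists_retraction U fun n x hn hx => by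
    rw [hU] at hx ⊢
    intro y hy
    have := hx y hy
    simpa [hn] using this
  have key : ∀ v : L, ∃ φ : L →ₗ[ℤ] ℤ, ∀ x ∈ U, E v x = c * φ x := fun v => by
    choose q hq using fun x : U => hcU v x x.2
    let ψ : U →ₗ[ℤ] ℤ :=
      { toFun := q
        map_add' := fun a b => mul_left_cancel₀ hc (by rw [mul_add, ← hq, ← hq, ← hq]; simp)
        map_smul' := fun a b => mul_left_cancel₀ hc (by
          rw [← hq]
          simp only [Submodule.coe_smul, map_smul, smul_eq_mul, hq, RingHom.id_apply]
          ring) }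
    refine ⟨ψ ∘ₗ r, fun x hx => ?_⟩
    have : r x = ⟨x, hx⟩ := hr ⟨x, hx⟩
    simpa [this, ψ] using hq ⟨x, hx⟩
  have hcN : c ∣ N := by
    obtain ⟨φ, hφ⟩ := key w
    obtain ⟨z, hz⟩ := hdual φ
    have h1 : φ u = 1 := mul_left_cancel₀ hc (by rw [← hφ u hu, huw, mul_one])
    have := hz u
    rw [h1, mul_one] at this
    exact this ▸ hcU z u hu
  obtain ⟨n, rfl⟩ := hcN
  obtain ⟨φ, hφ⟩ := key x
  obtain ⟨z, hz⟩ := hdual φ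
  have hmem : z - n • x ∈ U := by
    rw [hU]
    intro v hv
    simp only [map_sub, map_smul, LinearMap.sub_apply, LinearMap.smul_apply, smul_eq_mul, hz,
      hφ v hv]
    ring
  have h1 := hcU' _ hmem y
  simp only [map_sub, map_smul, LinearMap.sub_apply, LinearMap.smul_apply, smul_eq_mul, hz] at h1
  have h2 : c ∣ n * E x y := by
    rw [mul_assoc] at h1
    exact (dvd_sub_right (dvd_mul_right c _)).1 h1
  have h3 : IsRelPrime c n := (squarefree_mul_iff.1 hN).1
  exact h3.isCoprime.dvd_of_dvd_mul_left h2

/-- The orthogonal complement of two vectors. -/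
def perpPair (E : L →ₗ[ℤ] L →ₗ[ℤ] ℤ) (u w : L) : Submodule ℤ L :=
  LinearMap.ker (E u) ⊓ LinearMap.ker (E w)

theorem mem_perpPair {u w x : L} : x ∈ perpPair E u w ↔ E u x = 0 ∧ E w x = 0 := by
  simp [perpPair]

theorem exists_decomposition_perpPair (hE : E.IsAlt) {u w : L} {c : ℤ} (huw : E u w = c)
    (hcE : ∀ x y, c ∣ E x y) (x : L) :
    ∃ a b : ℤ, E x w = c * a ∧ E u x = c * b ∧ x - a • u - b • w ∈ perpPair E u w := by
  obtain ⟨a, ha⟩ := hcE x w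
  obtain ⟨b, hb⟩ := hcE u x
  have h1 : E w x = -(c * a) := by rw [← hE.neg, ha]
  have h2 : E w u = -c := by rw [← hE.neg, huw]
  refine ⟨a, b, ha, hb, ?_⟩
  rw [mem_perpPair]
  simp [huw, hb, h1, h2, hE.self_eq_zero]
  constructor <;> ring

theorem finrank_perpPair_lt [Module.Free ℤ L] [Module.Finite ℤ L] (hE : E.IsAlt) {u w : L}
    (huw : E u w ≠ 0) : Module.finrank ℤ (perpPair E u w) < Module.finrank ℤ L := by
  have hu : ∀ a : ℤ, a • u ∈ perpPair E u w → a = 0 := by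
    intro a h
    have h2 : E w u = - E u w := by rw [← hE.neg]
    simpa [mem_perpPair, h2, huw, hE.self_eq_zero] using h
  have hrank := (perpPair E u w).finrank_quotient_add_finrank
  by_contra hlt
  obtain ⟨a, ha, h⟩ := Module.finrank_eq_zero_iff.1
    (by omega : Module.finrank ℤ (L ⧸ perpPair E u w) = 0) (Submodule.Quotient.mk u)
  rw [← Submodule.Quotient.mk_smul, Submodule.Quotient.mk_eq_zero] at h
  exact ha (hu a h)

/-- Divisibility of the whole form by `c` serves twice: it makes the plane split off integrally, and
it gives `c ∣ f j` for the later entries. -/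
theorem IsAdapted.cons (hE : E.IsAlt) {u₀ w₀ : L} (hu₀ : u₀ ∈ U) {c : ℕ} (hc : 0 < c)
    (huw : E u₀ w₀ = c) (hcE : ∀ x y, (c : ℤ) ∣ E x y) {g : ℕ} {f : Fin g → ℕ}
    {u w : Fin g → perpPair E u₀ w₀}
    (h : IsAdapted (E.domRestrict₁₂ (perpPair E u₀ w₀) (perpPair E u₀ w₀))
      (U.comap (perpPair E u₀ w₀).subtype) f u w) :
    IsAdapted E U (Fin.cons c f : Fin (g + 1) → ℕ)
      (Fin.cons u₀ (fun i => (u i : L)) : Fin (g + 1) → L)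
      (Fin.cons w₀ (fun i => (w i : L)) : Fin (g + 1) → L) := by
  have hperp : ∀ x : perpPair E u₀ w₀, E u₀ x = 0 ∧ E w₀ x = 0 := fun x => mem_perpPair.1 x.2
  have hperp' : ∀ x : perpPair E u₀ w₀, E x u₀ = 0 ∧ E x w₀ = 0 := fun x =>
    ⟨hE.isRefl.eq_zero (hperp x).1, hE.isRefl.eq_zero (hperp x).2⟩
  have hpair : ∀ i j, E (u i) (w j) = if i = j then (f i : ℤ) else 0 := h.pair
  refine ⟨?_, ?_, ?_, ?_, ?_, ?_⟩
  · refine Fin.cases (by simpa using hu₀) fun i => ?_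
    simpa using h.mem i
  · refine Fin.cases (Fin.cases (by simpa using huw) fun j => ?_) fun i =>
      Fin.cases ?_ fun j => ?_
    · simp [(hperp (w j)).1, (Fin.succ_ne_zero j).symm]
    · simp [(hperp' (u i)).2]
    · simp [hpair i j]
  · refine Fin.cases (Fin.cases (by simpa using hE.self_eq_zero w₀) fun j => ?_) fun i =>
      Fin.cases ?_ fun j => ?_
    · simp [(hperp (w j)).2]
    · simp [(hperp' (w i)).2]
    · exact h.iso i j
  · refine Fin.cases (Fin.cases (by simp) fun j _ => ?_) fun i =>
      Fin.cases (fun hij => ?_) fun j hij => ?_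
    · have := hcE (u j) (w j)
      rw [hpair, if_pos rfl] at this
      simpa using Int.natCast_dvd_natCast.1 this
    · exact absurd hij (by simp)
    · simpa using h.dvd i j (by simpa using hij)
  · exact Fin.cases (by simpa using hc) fun i => by simpa using h.pos i
  · rw [eq_top_iff]
    intro x _
    obtain ⟨a, b, -, -, hx⟩ := exists_decomposition_perpPair hE huw hcE x
    set S := Submodule.span ℤ (Set.range (Fin.cons u₀ (fun i => (u i : L)) : Fin (g + 1) → L) ∪
      Set.range (Fin.cons w₀ (fun i => (w i : L)) : Fin (g + 1) → L)) with hS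
    have hu0 : u₀ ∈ S := Submodule.subset_span (Or.inl ⟨0, by simp⟩)
    have hw0 : w₀ ∈ S := Submodule.subset_span (Or.inr ⟨0, by simp⟩)
    have hle : Submodule.span ℤ (Set.range u ∪ Set.range w) ≤
        S.comap (perpPair E u₀ w₀).subtype := by
      rw [Submodule.span_le]
      rintro _ (⟨i, rfl⟩ | ⟨i, rfl⟩)
      · exact Submodule.subset_span (Or.inl ⟨i.succ, by simp⟩)
      · exact Submodule.subset_span (Or.inr ⟨i.succ, by simp⟩)
    rw [h.span] at hle
    have h1 : x - a • u₀ - b • w₀ ∈ S := hle (x := ⟨_, hx⟩) trivial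
    have h2 := S.add_mem (S.add_mem h1 (S.smul_mem b hw0)) (S.smul_mem a hu0)
    simpa using h2

end Lattice

theorem exists_isAdapted {L : Type*} [AddCommGroup L] [Module.Free ℤ L] [Module.Finite ℤ L]
    (E : L →ₗ[ℤ] L →ₗ[ℤ] ℤ) (hE : E.IsAlt) (N : ℤ) (hN : Squarefree N)
    (hdual : ∀ φ : L →ₗ[ℤ] ℤ, ∃ z, ∀ x, E z x = N * φ x)
    (U : Submodule ℤ L) (hU : ∀ x, x ∈ U ↔ ∀ y ∈ U, E x y = 0) :
    ∃ (g : ℕ) (f : Fin g → ℕ) (u w : Fin g → L), IsAdapted E U f u w := by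
  induction hn : Module.finrank ℤ L using Nat.strong_induction_on generalizing L with
  | _ n ih =>
    subst hn
    by_cases hU0 : U = ⊥
    · subst hU0
      -- When `U = 0` every vector is orthogonal to `U`, hence lies in `U`.
      have htop : ∀ x : L, x = 0 := fun x => by
        rw [← Submodule.mem_bot ℤ, hU]
        simp
      refine ⟨0, Fin.elim0, Fin.elim0, Fin.elim0, ⟨fun i => i.elim0, fun i => i.elim0,
        fun i => i.elim0, fun i => i.elim0, fun i => i.elim0, ?_⟩⟩
      rw [eq_top_iff]
      intro x _
      rw [htop x]
      exact Submodule.zero_mem _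
    · obtain ⟨v, hv, hv0⟩ := Submodule.exists_mem_ne_zero_of_ne_bot hU0
      have hN0 : N ≠ 0 := hN.ne_zero
      have hne : ∃ u ∈ U, ∃ w, E u w ≠ 0 := by
        obtain ⟨φ, hφ⟩ := Module.Projective.exists_dual_ne_zero ℤ hv0
        obtain ⟨z, hz⟩ := hdual φ
        refine ⟨v, hv, z, ?_⟩
        rw [← hE.neg, hz]
        simp [hN0, hφ]
      obtain ⟨u, hu, w, c, hc, huw, hcU⟩ := exists_pair_dvd_pairing hne
      have hcE : ∀ x y, (c : ℤ) ∣ E x y := by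
        refine dvd_form_of_dvd_pairing hN hdual hU hu (w := -w) (by omega) ?_ ?_ hcU
        · rw [map_neg, LinearMap.neg_apply, hE.neg, huw]
        · intro y x hx
          rw [← hE.neg, dvd_neg]
          exact hcU x hx y
      obtain ⟨g, f, u', w', h⟩ := ih _ (finrank_perpPair_lt hE (u := u) (w := w) (by omega))
        (E.domRestrict₁₂ (perpPair E u w) (perpPair E u w))
        (fun x => hE.self_eq_zero x) (fun φ => by
          choose a b ha hb hab using exists_decomposition_perpPair hE huw hcE
          have hc0 : (c : ℤ) ≠ 0 := by omega
          -- The orthogonal projection along `u, w` extends functionals from the complement to `L`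
          -- and carries the representing vector back.
          let π : L →ₗ[ℤ] perpPair E u w :=
            { toFun := fun x => ⟨_, hab x⟩
              map_add' := fun x y => by
                have h1 : a (x + y) = a x + a y :=
                  mul_left_cancel₀ hc0 (by rw [mul_add, ← ha, ← ha, ← ha]; simp)
                have h2 : b (x + y) = b x + b y :=
                  mul_left_cancel₀ hc0 (by rw [mul_add, ← hb, ← hb, ← hb]; simp)
                ext
                simp only [h1, h2, Submodule.coe_add]
                module
              map_smul' := fun n x => by
                have h1 : a (n • x) = n * a x :=
                  mul_left_cancel₀ hc0 (by rw [mul_left_comm, ← ha, ← ha]; simp)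
                have h2 : b (n • x) = n * b x :=
                  mul_left_cancel₀ hc0 (by rw [mul_left_comm, ← hb, ← hb]; simp)
                ext
                simp only [h1, h2, Submodule.coe_smul, RingHom.id_apply]
                module }
          have hπ : ∀ x : perpPair E u w, π x = x := fun x => by
            have hx := mem_perpPair.1 x.2
            have h1 : a x = 0 := by
              have := ha x
              rw [hE.isRefl.eq_zero hx.2] at this
              simpa [hc.ne'] using this.symm
            have h2 : b x = 0 := by
              have := hb x
              rw [hx.1] at this
              simpa [hc.ne'] using this.symm
            ext
            simp [π, h1, h2]
          obtain ⟨z, hz⟩ := hdual (φ ∘ₗ π)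
          refine ⟨π z, fun x => ?_⟩
          have hx := mem_perpPair.1 x.2
          have h3 := hz x
          rw [LinearMap.comp_apply, hπ] at h3
          rw [← h3, LinearMap.domRestrict₁₂_apply]
          simp [π, hx.1, hx.2])
        (U.comap (perpPair E u w).subtype) (fun x => by
          simp only [Submodule.mem_comap, Submodule.subtype_apply, LinearMap.domRestrict₁₂_apply]
          rw [hU]
          refine ⟨fun h y hy => h y hy, fun h y hy => ?_⟩
          obtain ⟨a, b, ha, hb, hab⟩ := exists_decomposition_perpPair hE huw hcE y
          -- Since `u` and `y` both lie in `U`, `y` has no `w`-component, and its projection stays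
          -- in `U`.
          have hb0 : b = 0 := by
            rw [(hU u).1 hu y hy] at hb
            simpa [hc.ne'] using hb.symm
          subst hb0
          rw [zero_smul, sub_zero] at hab
          have h1 := h ⟨_, hab⟩ (U.sub_mem hy (U.smul_mem a hu))
          have hx := mem_perpPair.1 x.2
          simpa [hE.isRefl.eq_zero hx.1] using h1) rfl
      exact ⟨g + 1, _, _, _, h.cons hE hu hc huw hcE⟩

/-! ### The standard form: determinant, rank modulo primes, elementary divisors -/

/-- The matrix `(0, F; -F, 0)` with `F = diag(f)`. -/
def stdMatrix {g : ℕ} {R : Type*} [CommRing R] (f : Fin g → R) : Matrix (Idx g) (Idx g) R :=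
  Matrix.fromBlocks 0 (Matrix.diagonal f) (-Matrix.diagonal f) 0

section StdMatrix

variable {g : ℕ} {R : Type*} [CommRing R]

theorem stdMatrix_map {S : Type*} [CommRing S] (φ : R →+* S) (f : Fin g → R) :
    (stdMatrix f).map φ = stdMatrix fun i => φ (f i) := by
  simp only [stdMatrix, Matrix.fromBlocks_map, Matrix.map_zero _ (map_zero φ)]
  congr 1
  · exact Matrix.diagonal_map (map_zero φ)
  · ext i j
    by_cases h : i = j <;> simp [h, Matrix.diagonal]

theorem polMatrix_eq (t : PolarisationType g) : polMatrix t = stdMatrix fun i => (t.e i : ℤ) := rfl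

theorem stdMatrix_smul (c : R) (f : Fin g → R) : stdMatrix (fun i => c * f i) = c • stdMatrix f := by
  rw [stdMatrix, stdMatrix, Matrix.fromBlocks_smul]
  simp only [smul_zero, smul_neg, ← Matrix.diagonal_smul]
  rfl

theorem stdMatrix_eq_diagonal_mul (f : Fin g → R) :
    stdMatrix f = Matrix.diagonal (Sum.elim f f) * -Matrix.J (Fin g) R := by
  rw [← Matrix.fromBlocks_diagonal, Matrix.J, Matrix.fromBlocks_neg, Matrix.fromBlocks_multiply]
  simp [stdMatrix]

theorem stdMatrix_eq_conj (f : Fin g → R) :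
    stdMatrix f = Matrix.diagonal (Sum.elim 1 f) * -Matrix.J (Fin g) R *
      Matrix.diagonal (Sum.elim 1 f) := by
  rw [← Matrix.fromBlocks_diagonal, Matrix.J, Matrix.fromBlocks_neg, Matrix.fromBlocks_multiply,
    Matrix.fromBlocks_multiply]
  simp [stdMatrix]

theorem vecMul_stdMatrix_dotProduct (f : Fin g → R) (x y : Idx g → R) :
    (x ᵥ* stdMatrix f) ⬝ᵥ y = ∑ i, f i * (x (Sum.inl i) * y (Sum.inr i) -
      x (Sum.inr i) * y (Sum.inl i)) := by
  rw [← Matrix.dotProduct_mulVec, stdMatrix, Matrix.fromBlocks_mulVec]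
  simp only [dotProduct, Fintype.sum_sum_type, Sum.elim_inl, Sum.elim_inr, Matrix.neg_mulVec,
    Matrix.zero_mulVec, Matrix.mulVec_diagonal, Pi.add_apply, Pi.neg_apply, Pi.zero_apply,
    Function.comp_apply, ← Finset.sum_add_distrib]
  exact Finset.sum_congr rfl fun i _ => by ring

/-- A matrix preserving `stdMatrix f`, with no `f i` zero, has determinant one. -/
theorem det_eq_one_of_mul_stdMatrix {K : Type*} [Field K] {f : Fin g → K} (hf : ∀ i, f i ≠ 0)
    {P : Matrix (Idx g) (Idx g) K} (hP : P * stdMatrix f * Pᵀ = stdMatrix f) : P.det = 1 := by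
  -- Conjugation by `diag(1, f)` turns `P` into a symplectic matrix.
  set D : Matrix (Idx g) (Idx g) K := Matrix.diagonal (Sum.elim 1 f) with hD
  set D' : Matrix (Idx g) (Idx g) K := Matrix.diagonal (Sum.elim 1 fun i => (f i)⁻¹) with hD'
  have h1 : D' * D = 1 := by
    rw [hD, hD', Matrix.diagonal_mul_diagonal, ← Matrix.diagonal_one]
    congr 1
    ext (i | i) <;> simp [hf]
  have h2 : D * D' = 1 := mul_eq_one_comm.1 h1
  have ht : Dᵀ = D := Matrix.diagonal_transpose _
  have ht' : D'ᵀ = D' := Matrix.diagonal_transpose _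
  rw [stdMatrix_eq_conj, ← hD] at hP
  have hQ : D' * P * D ∈ Matrix.symplecticGroup (Fin g) K := by
    rw [SymplecticGroup.mem_iff, ← neg_inj]
    calc -(D' * P * D * Matrix.J (Fin g) K * (D' * P * D)ᵀ)
        = D' * (P * (D * -Matrix.J (Fin g) K * D) * Pᵀ) * D' := by
          simp only [Matrix.transpose_mul, ht, ht', Matrix.mul_assoc, Matrix.mul_neg,
            Matrix.neg_mul]
      _ = (D' * D) * -Matrix.J (Fin g) K * (D * D') := by rw [hP]; simp only [Matrix.mul_assoc]
      _ = -Matrix.J (Fin g) K := by rw [h1, h2, one_mul, mul_one]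
  have h3 := SymplecticGroup.det_eq_one hQ
  have h4 : D'.det * D.det = 1 := by rw [← Matrix.det_mul, h1, Matrix.det_one]
  rw [Matrix.det_mul, Matrix.det_mul] at h3
  linear_combination h3 - P.det * h4

theorem rank_stdMatrix {K : Type*} [Field K] [DecidableEq K] (f : Fin g → K) :
    (stdMatrix f).rank = 2 * (Finset.univ.filter fun i => f i ≠ 0).card := by
  rw [stdMatrix_eq_diagonal_mul, Matrix.rank_mul_eq_left_of_isUnit_det, Matrix.rank_diagonal,
    Fintype.card_subtype]
  · simp only [Finset.card_filter, Fintype.sum_sum_type, Sum.elim_inl, Sum.elim_inr, two_mul]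
    congr!
  · rw [Matrix.det_neg]
    exact ((isUnit_one.neg).pow _).mul (Matrix.isUnit_det_J _ _)

/-- Both sides are half the rank of the form modulo `p`. -/
theorem card_not_dvd_eq {f f' : Fin g → ℕ} {P : Matrix (Idx g) (Idx g) ℤ} (hdet : IsUnit P.det)
    (hP : P * stdMatrix (fun i => (f i : ℤ)) * Pᵀ = stdMatrix fun i => (f' i : ℤ))
    (p : ℕ) [Fact p.Prime] :
    (Finset.univ.filter fun i => ¬ p ∣ f i).card = (Finset.univ.filter fun i => ¬ p ∣ f' i).card := by
  set φ := Int.castRingHom (ZMod p)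
  have hu : IsUnit (P.map φ).det := by
    have := hdet.map φ
    rwa [RingHom.map_det] at this
  have h := congrArg (fun A => (Matrix.map A φ).rank) hP
  simp only [Matrix.map_mul, stdMatrix_map, Matrix.transpose_map] at h
  rw [Matrix.rank_mul_eq_left_of_isUnit_det _ _ (by rwa [Matrix.det_transpose]),
    Matrix.rank_mul_eq_right_of_isUnit_det _ _ hu, rank_stdMatrix, rank_stdMatrix] at h
  simpa [φ, ZMod.natCast_eq_zero_iff] using h

/-- The elementary divisors are determined by the form, in the square-free case. -/
theorem eq_of_mul_stdMatrix {f f' : Fin g → ℕ} {P : Matrix (Idx g) (Idx g) ℤ}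
    (hdet : IsUnit P.det)
    (hP : P * stdMatrix (fun i => (f i : ℤ)) * Pᵀ = stdMatrix fun i => (f' i : ℤ))
    (hf : ∀ i j, i ≤ j → f i ∣ f j) (hf' : ∀ i j, i ≤ j → f' i ∣ f' j)
    (hs : ∀ i, Squarefree (f i)) (hs' : ∀ i, Squarefree (f' i)) : f = f' := by
  ext i
  rw [Nat.Squarefree.ext_iff (hs i) (hs' i)]
  intro p hp
  have : Fact p.Prime := ⟨hp⟩
  have hcard := card_not_dvd_eq hdet hP p
  have hlower : ∀ {k : Fin g → ℕ}, (∀ i j, i ≤ j → k i ∣ k j) →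
      IsLowerSet ((Finset.univ.filter fun i => ¬ p ∣ k i : Finset (Fin g)) : Set (Fin g)) := by
    intro k hk a b hab ha
    simp only [Finset.coe_filter, Finset.mem_univ, true_and, Set.mem_ofPred_eq] at ha ⊢
    exact fun h => ha (h.trans (hk _ _ hab))
  -- Lower sets of a linear order are nested, so equal cardinality forces equality.
  have heq : (Finset.univ.filter fun i => ¬ p ∣ f i) = Finset.univ.filter fun i => ¬ p ∣ f' i := by
    rcases (hlower hf).total (hlower hf') with h | h
    · exact Finset.eq_of_subset_of_card_le (Finset.coe_subset.1 h) hcard.ge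
    · exact (Finset.eq_of_subset_of_card_le (Finset.coe_subset.1 h) hcard.le).symm
  have := congrArg (i ∈ ·) heq
  simpa [not_iff_not] using this

/-- The alternating form on `R^{2g}` with matrix `stdMatrix f`. -/
def stdForm (f : Fin g → R) : (Idx g → R) →ₗ[R] (Idx g → R) →ₗ[R] R :=
  Matrix.toLinearMap₂' R (stdMatrix f)

theorem stdForm_apply (f : Fin g → R) (x y : Idx g → R) :
    stdForm f x y = (x ᵥ* stdMatrix f) ⬝ᵥ y := by
  rw [stdForm, Matrix.toLinearMap₂'_apply', Matrix.dotProduct_mulVec]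

theorem stdForm_apply_eq_sum (f : Fin g → R) (x y : Idx g → R) :
    stdForm f x y = ∑ i, f i * (x (Sum.inl i) * y (Sum.inr i) -
      x (Sum.inr i) * y (Sum.inl i)) := by
  rw [stdForm_apply, vecMul_stdMatrix_dotProduct]

theorem stdForm_isAlt (f : Fin g → R) : (stdForm f).IsAlt := fun x => by
  rw [stdForm_apply_eq_sum]
  exact Finset.sum_eq_zero fun i _ => by ring

theorem mul_stdMatrix_mul_transpose_apply (f : Fin g → R) (P : Matrix (Idx g) (Idx g) R)
    (a b : Idx g) : (P * stdMatrix f * Pᵀ) a b = stdForm f (P a) (P b) := by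
  rw [stdForm_apply]
  simp [Matrix.mul_apply, Matrix.vecMul, dotProduct, Matrix.transpose_apply]

theorem exists_stdForm_eq_mul {e : Fin g → ℤ} {N : ℤ} (he : ∀ i, e i ∣ N)
    (φ : (Idx g → ℤ) →ₗ[ℤ] ℤ) : ∃ z, ∀ x, stdForm e z x = N * φ x := by
  choose q hq using he
  refine ⟨Sum.elim (fun i => q i * φ (Pi.single (Sum.inr i) 1))
    (fun i => -(q i * φ (Pi.single (Sum.inl i) 1))), fun x => ?_⟩
  have hx : φ x = ∑ k, x k * φ (Pi.single k 1) := by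
    conv_lhs => rw [← (Pi.basisFun ℤ (Idx g)).sum_repr x]
    simp only [Pi.basisFun_repr, Pi.basisFun_apply, map_sum, map_smul, smul_eq_mul]
  rw [stdForm_apply_eq_sum, hx, Fintype.sum_sum_type, ← Finset.sum_add_distrib, Finset.mul_sum]
  refine Finset.sum_congr rfl fun i _ => ?_
  simp only [Sum.elim_inl, Sum.elim_inr]
  rw [hq i]
  ring

end StdMatrix

/-! ### Consequences of an adapted family -/

namespace IsAdapted

variable {L : Type*} [AddCommGroup L] {E : L →ₗ[ℤ] L →ₗ[ℤ] ℤ} {U : Submodule ℤ L}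
  {g : ℕ} {f : Fin g → ℕ} {u w : Fin g → L}

theorem linearIndependent (h : IsAdapted E U f u w)
    (hU : ∀ x ∈ U, ∀ y ∈ U, E x y = 0) : LinearIndependent ℤ (Sum.elim u w) := by
  have huu : ∀ i j, E (u i) (u j) = 0 := fun i j => hU _ (h.mem i) _ (h.mem j)
  rw [Fintype.linearIndependent_iff]
  intro c hc
  have h1 : ∀ j, c (Sum.inr j) = 0 := fun j => by
    have := congrArg (E (u j)) hc
    simpa [Fintype.sum_sum_type, huu, h.pair, (h.pos _).ne'] using this
  have h2 : ∀ j, c (Sum.inl j) = 0 := fun j => by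
    have := congrArg (fun x => E x (w j)) hc
    simpa [Fintype.sum_sum_type, h.iso, h.pair, (h.pos _).ne', h1] using this
  rintro (j | j)
  exacts [h2 j, h1 j]

theorem span_elim (h : IsAdapted E U f u w) :
    Submodule.span ℤ (Set.range (Sum.elim u w)) = ⊤ := by
  rw [Set.Sum.elim_range, h.span]

theorem span_range_left (h : IsAdapted E U f u w) (hU : ∀ x ∈ U, ∀ y ∈ U, E x y = 0) :
    Submodule.span ℤ (Set.range u) = U := by
  have hle : Submodule.span ℤ (Set.range u) ≤ U :=
    Submodule.span_le.2 (Set.range_subset_iff.2 h.mem)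
  refine le_antisymm hle fun x hx => ?_
  have hx' : x ∈ Submodule.span ℤ (Set.range u) ⊔ Submodule.span ℤ (Set.range w) := by
    rw [← Submodule.span_union, h.span]; trivial
  obtain ⟨y, hy, z, hz, rfl⟩ := Submodule.mem_sup.1 hx'
  obtain ⟨c, rfl⟩ := (Submodule.mem_span_range_iff_exists_fun ℤ).1 hz
  have hc : ∀ j, c j = 0 := fun j => by
    have := hU _ (h.mem j) _ hx
    rw [map_add, hU _ (h.mem j) _ (hle hy), zero_add] at this
    simpa [h.pair, (h.pos _).ne'] using this
  simpa [hc] using hy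

/-- Represent `N` times the coordinate along `w i` by `z`: then `N = E z (w i)`, and every pairing
with `w i` is a multiple of `f i`. -/
theorem dvd_of_dual (h : IsAdapted E U f u w) {N : ℤ}
    (hU : ∀ x ∈ U, ∀ y ∈ U, E x y = 0)
    (hdual : ∀ φ : L →ₗ[ℤ] ℤ, ∃ z, ∀ x, E z x = N * φ x) (i : Fin g) : (f i : ℤ) ∣ N := by
  let b := Module.Basis.mk (h.linearIndependent hU) h.span_elim.ge
  obtain ⟨z, hz⟩ := hdual (b.coord (Sum.inr i))
  have h1 : b (Sum.inr i) = w i := by simp [b]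
  have h2 := hz (w i)
  rw [← h1, Module.Basis.coord_apply, Module.Basis.repr_self, Finsupp.single_eq_same, mul_one,
    h1] at h2
  rw [← h2]
  have hle : Submodule.span ℤ (Set.range u ∪ Set.range w) ≤
      Submodule.comap (E.flip (w i)) (Ideal.span {(f i : ℤ)}) := by
    rw [Submodule.span_le]
    rintro _ (⟨j, rfl⟩ | ⟨j, rfl⟩)
    · rw [SetLike.mem_coe, Submodule.mem_comap, LinearMap.flip_apply, h.pair,
        Ideal.mem_span_singleton]
      split_ifs with hij
      · rw [hij]
      · exact dvd_zero _
    · simp [h.iso]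
  rw [h.span] at hle
  have h3 : z ∈ Submodule.comap (E.flip (w i)) (Ideal.span {(f i : ℤ)}) := hle trivial
  rwa [Submodule.mem_comap, LinearMap.flip_apply, Ideal.mem_span_singleton] at h3

end IsAdapted

/-! ### Reduction of the paramodular setting to the lattice problem -/

variable {g : ℕ}

/-- Here `m = e₁`, the reduced entries are the partial products of the `d_i`, and `N` is their full
product, square-free by coprimality. -/
theorem PolarisationType.exists_squarefree_scaling (t : PolarisationType g) (hsq : t.IsSquarefree)
    (hco : t.IsCoprime) : ∃ (m N : ℕ) (e : Fin g → ℕ), 0 < m ∧ Squarefree N ∧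
      (∀ i, t.e i = m * e i) ∧ (∀ i, e i ∣ N) ∧ ∀ i j, i ≤ j → e i ∣ e j := by
  rcases g with _ | n
  · exact ⟨1, 1, Fin.elim0, one_pos, squarefree_one, fun i => i.elim0, fun i => i.elim0,
      fun i => i.elim0⟩
  · refine ⟨t.e 0, ∏ i, t.d i,
      fun j => ∏ i ∈ Finset.univ.filter fun i : Fin (n + 1 - 1) => (i : ℕ) < j, t.d i,
      t.pos 0, ?_, ?_, ?_, ?_⟩
    · refine Finset.squarefree_prod_of_pairwise_isCoprime ?_ fun i _ => hsq i
      intro i _ j _ hij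
      exact Nat.coprime_iff_isRelPrime.1 (hco i j hij)
    · rintro ⟨k, hk⟩
      induction k with
      | zero => simp
      | succ k ih =>
        have h1 : t.e ⟨k + 1, hk⟩ = t.e ⟨k, by omega⟩ * t.d ⟨k, by omega⟩ :=
          (Nat.mul_div_cancel' (t.dvd_succ ⟨k, by omega⟩ ⟨k + 1, hk⟩ rfl)).symm
        have h2 : (Finset.univ.filter fun i : Fin (n + 1 - 1) => (i : ℕ) < k + 1) =
            insert ⟨k, by omega⟩
              (Finset.univ.filter fun i : Fin (n + 1 - 1) => (i : ℕ) < k) := by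
          ext i
          simp [Fin.ext_iff]
          omega
        rw [h1, ih (by omega)]
        simp only [h2]
        rw [Finset.prod_insert (by simp)]
        ring
    · exact fun j => Finset.prod_dvd_prod_of_subset _ _ _ (Finset.filter_subset _ _)
    · intro i j hij
      refine Finset.prod_dvd_prod_of_subset _ _ _ fun k hk => ?_
      simp only [Finset.mem_filter, Finset.mem_univ, true_and] at hk ⊢
      exact hk.trans_le hij

theorem mem_integralPoints {V : Submodule ℚ (Idx g → ℚ)} {x : Idx g → ℤ} :
    x ∈ integralPoints V ↔ (fun k => (x k : ℚ)) ∈ V := Iff.rfl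

theorem polForm_eq_stdForm (t : PolarisationType g) (x y : Idx g → ℚ) :
    polForm t x y = stdForm (fun i => (t.e i : ℚ)) x y := by
  rw [polForm, toRat, polMatrix_eq, stdMatrix_map, stdForm_apply]
  simp

theorem stdForm_intCast (f : Fin g → ℤ) (x y : Idx g → ℤ) :
    stdForm (fun i => (f i : ℚ)) (fun k => (x k : ℚ)) (fun k => (y k : ℚ)) =
      (stdForm f x y : ℤ) := by
  simp [stdForm_apply_eq_sum]

theorem stdForm_separating {K : Type*} [Field K] {f : Fin g → K} (hf : ∀ i, f i ≠ 0)
    {x : Idx g → K} (hx : ∀ y, stdForm f x y = 0) : x = 0 := by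
  ext (i | i)
  · have := hx (Pi.single (Sum.inr i) 1)
    simpa [stdForm_apply_eq_sum, Pi.single_apply, hf] using this
  · have := hx (Pi.single (Sum.inl i) 1)
    simpa [stdForm_apply_eq_sum, Pi.single_apply, hf] using this

theorem exists_int_smul_eq_cast {ι : Type*} [Finite ι] (x : ι → ℚ) :
    ∃ (n : ℤ) (y : ι → ℤ), n ≠ 0 ∧ ∀ k, (y k : ℚ) = n * x k := by
  obtain ⟨n, hn⟩ := IsLocalization.exist_integer_multiples_of_finite (nonZeroDivisors ℤ) x
  choose y hy using hn
  refine ⟨n, y, nonZeroDivisors.ne_zero n.2, fun k => ?_⟩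
  have := hy k
  simpa [Submonoid.smul_def] using this

/-- The orthogonal of `h` contains `h` and has dimension `2g - g = g`. -/
theorem mem_iff_of_topIsotropic (t : PolarisationType g) (h : TopIsotropic t) (x : Idx g → ℚ) :
    x ∈ h.1 ↔ ∀ y ∈ h.1, polForm t x y = 0 := by
  set B : LinearMap.BilinForm ℚ (Idx g → ℚ) := stdForm fun i => (t.e i : ℚ) with hB
  have hne : ∀ i, (t.e i : ℚ) ≠ 0 := fun i => by exact_mod_cast (t.pos i).ne'
  have halt : B.IsAlt := stdForm_isAlt _
  have hnd : B.Nondegenerate := by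
    refine halt.isRefl.nondegenerate_iff_separatingLeft.2 ?_
    exact fun x hx => stdForm_separating hne hx
  have hle : h.1 ≤ B.orthogonal h.1 := fun x hx y hy => by
    have := h.2.1 y hy x hx
    rwa [polForm_eq_stdForm] at this
  have heq := Submodule.eq_of_le_of_finrank_eq hle (by
    rw [LinearMap.BilinForm.finrank_orthogonal hnd, h.2.2, Module.finrank_fintype_fun_eq_card]
    simp)
  refine ⟨fun hx y hy => h.2.1 x hx y hy, fun hx => ?_⟩
  rw [heq]
  intro y hy
  apply halt.isRefl.eq_zero
  rw [hB, ← polForm_eq_stdForm]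
  exact hx y hy

theorem mem_integralPoints_iff (t : PolarisationType g) (h : TopIsotropic t) {m : ℕ} (hm : 0 < m)
    {e : Fin g → ℕ} (he : ∀ i, t.e i = m * e i) (x : Idx g → ℤ) :
    x ∈ integralPoints h.1 ↔ ∀ y ∈ integralPoints h.1, stdForm (fun i => (e i : ℤ)) x y = 0 := by
  have hpol : ∀ x y : Idx g → ℤ, polForm t (fun k => (x k : ℚ)) (fun k => (y k : ℚ)) =
      m * (stdForm (fun i => (e i : ℤ)) x y : ℤ) := fun x y => by
    rw [polForm_eq_stdForm, ← stdForm_intCast, stdForm_apply_eq_sum, stdForm_apply_eq_sum,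
      Finset.mul_sum]
    refine Finset.sum_congr rfl fun i _ => ?_
    rw [he]
    push_cast
    ring
  have hm' : (m : ℚ) ≠ 0 := by exact_mod_cast hm.ne'
  rw [mem_integralPoints, mem_iff_of_topIsotropic]
  constructor
  · intro hx y hy
    have := hx _ hy
    rw [hpol] at this
    simpa [hm.ne'] using this
  · intro hx y hy
    obtain ⟨n, z, hn, hz⟩ := exists_int_smul_eq_cast y
    have hzy : (fun k => (z k : ℚ)) = (n : ℚ) • y := funext hz
    have h1 := hpol x z
    rw [hx z (by rw [mem_integralPoints, hzy]; exact h.1.smul_mem _ hy), hzy, polForm_eq_stdForm,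
      map_smul, ← polForm_eq_stdForm] at h1
    simpa [hn] using h1

theorem exists_basis_vecMul_eq_single (t : PolarisationType g) (hsq : t.IsSquarefree)
    (hco : t.IsCoprime) (h : TopIsotropic t) :
    ∃ u : Module.Basis (Fin g) ℤ (integralPoints h.1), ∃ M ∈ paramodularGroup t,
      ∀ i : Fin g, (u i : Idx g → ℤ) ᵥ* (M : Matrix (Idx g) (Idx g) ℤ) =
        Pi.single (Sum.inl i) 1 := by
  obtain ⟨m, N, e, hm, hN, he, heN, hchain⟩ := t.exists_squarefree_scaling hsq hco
  have halt := stdForm_isAlt fun i => (e i : ℤ)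
  have hU := mem_integralPoints_iff t h hm he
  have hiso : ∀ x ∈ integralPoints h.1, ∀ y ∈ integralPoints h.1,
      stdForm (fun i => (e i : ℤ)) x y = 0 := fun x hx => (hU x).1 hx
  have hdual := exists_stdForm_eq_mul (e := fun i => (e i : ℤ)) (N := N)
    fun i => Int.natCast_dvd_natCast.2 (heN i)
  obtain ⟨g', f, u, w, had⟩ := exists_isAdapted _ halt N (Int.squarefree_natCast.2 hN) hdual _ hU
  have hli := had.linearIndependent hiso
  obtain rfl : g' = g := by
    have h1 := Module.finrank_eq_card_basis (Module.Basis.mk hli had.span_elim.ge)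
    rw [Module.finrank_fintype_fun_eq_card] at h1
    simp only [Fintype.card_sum, Fintype.card_fin] at h1
    omega
  let P : Matrix (Idx g') (Idx g') ℤ := Matrix.of (Sum.elim u w)
  have hdet : IsUnit P.det := by
    have := (Module.Basis.is_basis_iff_det (Pi.basisFun ℤ (Idx g'))).1 ⟨hli, had.span_elim⟩
    rwa [Pi.basisFun_det] at this
  have hP : P * stdMatrix (fun i => (e i : ℤ)) * Pᵀ = stdMatrix fun i => (f i : ℤ) := by
    ext a b
    rw [mul_stdMatrix_mul_transpose_apply]
    rcases a with i | i <;> rcases b with j | j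
    · exact hiso _ (had.mem i) _ (had.mem j)
    · exact (had.pair i j).trans (Matrix.diagonal_apply (fun i => (f i : ℤ)) i j).symm
    · have := had.pair j i
      rw [← halt.neg, neg_eq_iff_eq_neg] at this
      refine this.trans (congrArg Neg.neg ?_)
      rw [Matrix.diagonal_apply]
      by_cases hij : i = j
      · subst hij; simp
      · rw [if_neg hij, if_neg (Ne.symm hij)]
    · exact had.iso i j
  have hfN : ∀ i, f i ∣ N := fun i =>
    Int.natCast_dvd_natCast.1 (had.dvd_of_dual hiso hdual i)
  obtain rfl : e = f := eq_of_mul_stdMatrix hdet hP hchain had.dvd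
    (fun i => hN.squarefree_of_dvd (heN i)) (fun i => hN.squarefree_of_dvd (hfN i))
  have hdet1 : P.det = 1 := by
    have h1 := congrArg (fun A : Matrix (Idx g') (Idx g') ℤ => A.map (Int.castRingHom ℚ)) hP
    simp only [Matrix.map_mul, stdMatrix_map, Matrix.transpose_map] at h1
    have h2 := det_eq_one_of_mul_stdMatrix (fun i => by simpa using (had.pos i).ne') h1
    have h3 : ((P.det : ℤ) : ℚ) = 1 := by
      rw [← h2]
      exact RingHom.map_det (Int.castRingHom ℚ) P
    exact_mod_cast h3
  let Q : Matrix.SpecialLinearGroup (Idx g') ℤ := ⟨P, hdet1⟩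
  have hQ : Q ∈ paramodularGroup t := by
    change P * polMatrix t * Pᵀ = polMatrix t
    have : polMatrix t = (m : ℤ) • stdMatrix fun i => (e i : ℤ) := by
      rw [← stdMatrix_smul, polMatrix_eq]
      simp [he]
    rw [this, Matrix.mul_smul, Matrix.smul_mul, hP]
  have hliu : LinearIndependent ℤ u := hli.comp Sum.inl Sum.inl_injective
  -- `Q` sends the unit vectors to the rows `u i`, so its inverse is the required element.
  refine ⟨(Module.Basis.span hliu).map (LinearEquiv.ofEq _ _ (had.span_range_left hiso)), Q⁻¹,
    inv_mem hQ, fun i => ?_⟩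
  have hrow : (Pi.single (Sum.inl i) 1 : Idx g' → ℤ) ᵥ* P = u i := by
    rw [Matrix.single_one_vecMul]
    rfl
  have hinv : P * ((Q⁻¹ : Matrix.SpecialLinearGroup (Idx g') ℤ) : Matrix (Idx g') (Idx g') ℤ) =
      1 := by
    change ((Q : Matrix.SpecialLinearGroup (Idx g') ℤ) : Matrix (Idx g') (Idx g') ℤ) * _ = 1
    rw [← Matrix.SpecialLinearGroup.coe_mul, mul_inv_cancel, Matrix.SpecialLinearGroup.coe_one]
  have hui : (((Module.Basis.span hliu).map
      (LinearEquiv.ofEq _ _ (had.span_range_left hiso)) i : integralPoints h.1) : Idx g' → ℤ) =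
      u i := by
    simp [Module.Basis.span_apply]
  rw [hui, ← hrow, Matrix.vecMul_vecMul, hinv, Matrix.vecMul_one]

/-! ### Transitivity through a standard subspace -/

/-- The span of the first `g` standard unit vectors. -/
def stdSubspace (g : ℕ) : Submodule ℚ (Idx g → ℚ) :=
  Submodule.span ℚ (Set.range fun i : Fin g => (Pi.single (Sum.inl i) 1 : Idx g → ℚ))

theorem finrank_stdSubspace (g : ℕ) : Module.finrank ℚ (stdSubspace g) = g := by
  have hli : LinearIndependent ℚ fun i : Fin g => (Pi.single (Sum.inl i) 1 : Idx g → ℚ) :=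
    (Pi.linearIndependent_single_one (Idx g) ℚ).comp Sum.inl Sum.inl_injective
  exact (finrank_span_eq_card hli).trans (Fintype.card_fin g)

theorem isIsotropic_stdSubspace (t : PolarisationType g) : IsIsotropic t (stdSubspace g) := by
  have h : ∀ x ∈ stdSubspace g, ∀ i, x (Sum.inr i) = 0 := by
    intro x hx i
    have hle : stdSubspace g ≤ LinearMap.ker (LinearMap.proj (Sum.inr i) : (Idx g → ℚ) →ₗ[ℚ] ℚ) :=
      Submodule.span_le.2 (Set.range_subset_iff.2 fun j => by simp)
    exact hle hx
  intro x hx y hy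
  rw [polForm_eq_stdForm, stdForm_apply_eq_sum]
  exact Finset.sum_eq_zero fun i _ => by rw [h x hx, h y hy]; ring

theorem exists_map_rightMul_eq_stdSubspace (t : PolarisationType g) (hsq : t.IsSquarefree)
    (hco : t.IsCoprime) (h : TopIsotropic t) :
    ∃ M ∈ paramodularGroup t, h.1.map (rightMul M) = stdSubspace g := by
  obtain ⟨u, M, hM, hu⟩ := exists_basis_vecMul_eq_single t hsq hco h
  refine ⟨M, hM, (Submodule.eq_of_le_of_finrank_eq (Submodule.span_le.2 ?_) ?_).symm⟩
  · rintro _ ⟨i, rfl⟩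
    refine ⟨_, (u i).2, ?_⟩
    rw [rightMul_apply]
    have h1 := congrArg (fun x : Idx g → ℤ => fun k => Int.castRingHom ℚ (x k)) (hu i)
    simp only [RingHom.map_vecMul] at h1
    refine h1.trans ?_
    ext k
    simp [Pi.single_apply]
  · refine (finrank_stdSubspace g).trans (h.2.2.symm.trans ?_)
    exact LinearEquiv.finrank_eq (Submodule.equivMapOfInjective _ (rightMul_injective M) h.1)

end Paramodular

theorem mainTheorem3 (g : ℕ) (t : Paramodular.PolarisationType g)
    (hsq : t.IsSquarefree) (hco : t.IsCoprime) :
    MulAction.IsPretransitive (Paramodular.paramodularGroup t)ᵐᵒᵖ (Paramodular.TopIsotropic t) ∧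
    Nat.card (Paramodular.TopCusps t) = 1 ∧
    ∀ h : Paramodular.TopIsotropic t,
      ∃ u : Module.Basis (Fin g) ℤ (Paramodular.integralPoints h.1),
      ∃ M ∈ Paramodular.paramodularGroup t,
        ∀ i : Fin g, (u i : Paramodular.Idx g → ℤ) ᵥ*
            (M : Matrix (Paramodular.Idx g) (Paramodular.Idx g) ℤ) =
          Pi.single (Sum.inl i) 1 := by
  let V₀ : Paramodular.TopIsotropic t := ⟨Paramodular.stdSubspace g,
    Paramodular.isIsotropic_stdSubspace t, Paramodular.finrank_stdSubspace g⟩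
  have htrans : MulAction.IsPretransitive (Paramodular.paramodularGroup t)ᵐᵒᵖ
      (Paramodular.TopIsotropic t) := by
    have key : ∀ V : Paramodular.TopIsotropic t,
        ∃ M : (Paramodular.paramodularGroup t)ᵐᵒᵖ, M • V = V₀ := fun V => by
      obtain ⟨M, hM, h⟩ := Paramodular.exists_map_rightMul_eq_stdSubspace t hsq hco V
      exact ⟨MulOpposite.op ⟨M, hM⟩, Subtype.ext h⟩
    refine ⟨fun V W => ?_⟩
    obtain ⟨M, hM⟩ := key V
    obtain ⟨M', hM'⟩ := key W
    exact ⟨M'⁻¹ * M, by rw [mul_smul, hM, ← hM', inv_smul_smul]⟩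
  refine ⟨htrans, ?_, Paramodular.exists_basis_vecMul_eq_single t hsq hco⟩
  rw [Nat.card_eq_one_iff_unique]
  exact ⟨(MulAction.pretransitive_iff_subsingleton_quotient _ _).1 htrans,
    ⟨Quotient.mk'' V₀⟩⟩
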